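/- Let $k$ be a field of characteristic $p>0$, let $G$ be an algebraic affine group scheme over $k$ (so $k[G]$ is a finitely generated commutative Hopf algebra over $k$), and let $r>0$ be an integer. Let $\mathbb G_{a(r)}=\operatorname{Spec} k[T]/(T^{p^r})$ be the $r$-th Frobenius kernel of the additive group, and let $u_{r-1}\colon k[\mathbb G_{a(r)}]\to k$ be the linear functional dual to $T^{p^{r-1}}$ with respect to the basis $1,T,\dots,T^{p^r-1}$. Let $V_r(G)=\operatorname{Spec} k[V_r(G)]$ be the affine scheme representing the functor $R\mapsto \operatorname{Hom}_{\text{grp sch}/R}(\mathbb G_{a(r),R},G_R)$ on commutative $k$-algebras, with universal one-parameter subgroup $\mathcal U_{G,r}\colon \mathbb G_{a(r),k[V_r(G)]}\to G_{k[V_r(G)]}$. Let $\Theta_{G,r}\colon k[G]\to k[V_r(G)]$ be the $k$-linear composite $$k[G]\xrightarrow{\,1\otimes \mathrm{id}\,} k[V_r(G)]\otimes k[G]\xrightarrow{\ \mathcal U_{G,r}^*\ } k[V_r(G)]\otimes k[\mathbb G_{a(r)}]\xrightarrow{\,\mathrm{id}\otimes u_{r-1}\,} k[V_r(G)].$$ Precomposition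 with multiplication by scalars on $\mathbb G_{a(r)}$ defines an action $V_r(G)\times\mathbb A^1\to V_r(G)$, with coaction $k[V_r(G)]\to k[V_r(G)]\otimes k[t]$; an element $a\in k[V_r(G)]$ is called homogeneous of degree $n$ if its coaction is $a\otimes t^n$. This makes $k[V_r(G)]$ an $\mathbb N$-graded $k$-algebra, generated by homogeneous elements of degrees $p^i$, $0\le i<r$. With respect to this grading: (1) The image of $\Theta_{G,r}$ is contained in the homogeneous summand of $k[V_r(G)]$ of degree $p^{r-1}$. (2) Suppose that $G$ is infinitesimal, i.e. $k[G]$ is finite dimensional and local, and for some $s$ all $x$ in its maximal ideal satisfy $x^{p^s}=0$. Let $kG=\operatorname{Hom}_k(k[G],k)$ and $k\mathbb G_{a(r)}=\operatorname{Hom}_k(k[\mathbb G_{a(r)}],k)$. Then (1) is equivalent to the following: the map $\mathcal U_{G,r,*}\colon k\mathbb G_{a(r)}\otimes k[V_r(G)]\to kG\otimes k[V_r(G)]$ induced by $\mathcal U_{G,r}$ sends $u_{r-1}\otimes 1$ to an element of the form $\sum_i x_i\otimes a_i$ (finite sum) with each $a_i\in k[V_r(G)]$ homogeneous of degree $p^{r-1}$.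 -/

import Mathlib

open scoped TensorProduct Polynomial

noncomputable section

namespace OneParam

section Ga

variable (k : Type*) [Field k] (p r : ℕ)

/-- The coordinate algebra `k[𝔾_{a(r)}] = k[T]/(T^{p^r})`. -/
def GaCoord : Type _ := AdjoinRoot ((Polynomial.X : k[X]) ^ p ^ r)

instance : CommRing (GaCoord k p r) :=
  inferInstanceAs (CommRing (AdjoinRoot ((Polynomial.X : k[X]) ^ p ^ r)))

instance : Algebra k (GaCoord k p r) :=
  inferInstanceAs (Algebra k (AdjoinRoot ((Polynomial.X : k[X]) ^ p ^ r)))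

/-- The coordinate function `T`. -/
def GaCoord.T : GaCoord k p r := AdjoinRoot.root ((Polynomial.X : k[X]) ^ p ^ r)

theorem adjoinRoot_basis_apply (N : ℕ) (i : Fin N) :
    ((AdjoinRoot.powerBasis' (Polynomial.monic_X_pow (R := k) N)).basis.reindex
      (finCongr (Polynomial.natDegree_X_pow (R := k) N))) i =
    AdjoinRoot.root ((Polynomial.X : k[X]) ^ N) ^ (i : ℕ) := by
  rw [Module.Basis.reindex_apply, PowerBasis.basis_eq_pow]
  rfl

/-- The basis `1, T, …, T^{p^r - 1}`. -/
def GaCoord.basis : Module.Basis (Fin (p ^ r)) k (GaCoord k p r) :=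
  (AdjoinRoot.powerBasis' (Polynomial.monic_X_pow (R := k) (p ^ r))).basis.reindex
    (finCongr (Polynomial.natDegree_X_pow (R := k) (p ^ r)))

theorem GaCoord.basis_apply (i : Fin (p ^ r)) :
    GaCoord.basis k p r i = GaCoord.T k p r ^ (i : ℕ) :=
  adjoinRoot_basis_apply k (p ^ r) i

theorem GaCoord.T_pow : GaCoord.T k p r ^ p ^ r = 0 := by
  have h := AdjoinRoot.eval₂_root ((Polynomial.X : k[X]) ^ p ^ r)
  rw [Polynomial.eval₂_pow, Polynomial.eval₂_X] at h
  exact h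

variable {k p r}

/-- A point `b` with `b^{p^r} = 0` of a `k`-algebra `B` is a homomorphism out of `k[T]/(T^{p^r})`. -/
def GaCoord.lift {B : Type*} [CommRing B] [Algebra k B] (b : B) (hb : b ^ p ^ r = 0) :
    GaCoord k p r →ₐ[k] B :=
  AdjoinRoot.liftAlgHom ((Polynomial.X : k[X]) ^ p ^ r) (Algebra.ofId k B) b (by simp [hb])

@[simp]
theorem GaCoord.lift_T {B : Type*} [CommRing B] [Algebra k B] (b : B) (hb : b ^ p ^ r = 0) :
    GaCoord.lift b hb (GaCoord.T k p r) = b :=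
  AdjoinRoot.liftAlgHom_root _ _ _ _

theorem GaCoord.hom_ext {B : Type*} [Semiring B] [Algebra k B] {f g : GaCoord k p r →ₐ[k] B}
    (h : f (GaCoord.T k p r) = g (GaCoord.T k p r)) : f = g :=
  AdjoinRoot.algHom_ext (S := B) (f := (Polynomial.X : k[X]) ^ p ^ r) h

variable [Fact p.Prime]

variable (k p r) in
theorem GaCoord.counit_aux : (0 : k) ^ p ^ r = 0 :=
  zero_pow (pow_ne_zero _ (Fact.out : p.Prime).ne_zero)

variable [CharP k p]

variable (k) in
theorem add_pow_eq_zero {B : Type*} [CommRing B] [Algebra k B] {x y : B}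
    (hx : x ^ p ^ r = 0) (hy : y ^ p ^ r = 0) : (x + y) ^ p ^ r = 0 := by
  rcases subsingleton_or_nontrivial B with h | h
  · exact Subsingleton.elim _ _
  · have : CharP B p := charP_of_injective_algebraMap (algebraMap k B).injective p
    rw [add_pow_char_pow, hx, hy, add_zero]

variable (k p r)

theorem GaCoord.comul_aux :
    (GaCoord.T k p r ⊗ₜ[k] (1 : GaCoord k p r) + (1 : GaCoord k p r) ⊗ₜ[k] GaCoord.T k p r)
      ^ p ^ r = 0 :=
  add_pow_eq_zero k (by simp [Algebra.TensorProduct.tmul_pow, GaCoord.T_pow])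
    (by simp [Algebra.TensorProduct.tmul_pow, GaCoord.T_pow])

/-- The comultiplication `T ↦ T ⊗ 1 + 1 ⊗ T`. -/
def GaCoord.comulHom : GaCoord k p r →ₐ[k] GaCoord k p r ⊗[k] GaCoord k p r :=
  GaCoord.lift (GaCoord.T k p r ⊗ₜ 1 + 1 ⊗ₜ GaCoord.T k p r)
    (GaCoord.comul_aux k p r)

/-- The counit `T ↦ 0`. -/
def GaCoord.counitHom : GaCoord k p r →ₐ[k] k :=
  GaCoord.lift 0 (GaCoord.counit_aux k p r)

/-- The antipode `T ↦ -T`. -/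
def GaCoord.antipodeHom : GaCoord k p r →ₐ[k] GaCoord k p r :=
  GaCoord.lift (-GaCoord.T k p r) (by rw [neg_pow, GaCoord.T_pow, mul_zero])

instance : Bialgebra k (GaCoord k p r) :=
  Bialgebra.ofAlgHom (GaCoord.comulHom k p r) (GaCoord.counitHom k p r)
    (GaCoord.hom_ext (by
      simp [GaCoord.comulHom, TensorProduct.add_tmul, TensorProduct.tmul_add,
        Algebra.TensorProduct.one_def, add_assoc]))
    (GaCoord.hom_ext (by simp [GaCoord.comulHom, GaCoord.counitHom]))
    (GaCoord.hom_ext (by simp [GaCoord.comulHom, GaCoord.counitHom]))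

theorem GaCoord.comulAlgHom_T : Bialgebra.comulAlgHom k (GaCoord k p r) (GaCoord.T k p r) =
    GaCoord.T k p r ⊗ₜ 1 + 1 ⊗ₜ GaCoord.T k p r :=
  GaCoord.lift_T _ (GaCoord.comul_aux k p r)

theorem GaCoord.counitAlgHom_T : Bialgebra.counitAlgHom k (GaCoord k p r) (GaCoord.T k p r) = 0 :=
  GaCoord.lift_T _ (GaCoord.counit_aux k p r)

instance : HopfAlgebra k (GaCoord k p r) :=
  HopfAlgebra.ofAlgHom (GaCoord.antipodeHom k p r)
    (GaCoord.hom_ext (by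
      simp only [AlgHom.comp_apply, GaCoord.comulAlgHom_T, GaCoord.counitAlgHom_T]
      simp [GaCoord.antipodeHom]))
    (GaCoord.hom_ext (by
      simp only [AlgHom.comp_apply, GaCoord.comulAlgHom_T, GaCoord.counitAlgHom_T]
      simp [GaCoord.antipodeHom]))

end Ga

section Points

variable {k : Type*} [Field k] {V : Type*} [AddCommGroup V] [Module k V]
  {R : Type*} [CommRing R] [Algebra k R] {R' : Type*} [CommRing R'] [Algebra k R']
  {H : Type*} [CommRing H] [Bialgebra k H] {Q : Type*} [CommRing Q] [Bialgebra k Q]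

variable (R) in
/-- The contraction `id ⊗ l : R ⊗ V → R` along a linear functional `l` on `V`. -/
def pair (l : V →ₗ[k] k) : R ⊗[k] V →ₗ[R] R :=
  (TensorProduct.AlgebraTensorModule.rid k R R).toLinearMap ∘ₗ l.baseChange R

@[simp]
theorem pair_tmul (l : V →ₗ[k] k) (a : R) (v : V) : pair R l (a ⊗ₜ v) = l v • a := by
  simp [pair]

theorem pair_map (g : R →ₐ[k] R') (l : V →ₗ[k] k) (z : R ⊗[k] V) :
    pair R' l (TensorProduct.map g.toLinearMap LinearMap.id z) = g (pair R l z) := by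
  induction z with
  | zero => simp
  | add x y hx hy => simp [hx, hy]
  | tmul a v => simp

theorem eq_zero_of_pair (z : R ⊗[k] V) (h : ∀ l : V →ₗ[k] k, pair R l z = 0) : z = 0 := by
  let b := Module.Basis.ofVectorSpace k V
  refine (b.baseChange R).ext_elem fun i => ?_
  have h1 : ∀ z : R ⊗[k] V, (b.baseChange R).repr z i = pair R (b.coord i) z := by
    intro z
    induction z with
    | zero => simp
    | add x y hx hy => simp [hx, hy]
    | tmul a v => simp
  rw [h1, h, map_zero]; rfl

/-- The convolution `(φ ⊗ φ) : H ⊗ H → R ⊗ (Q ⊗ Q)` of a linear map `φ : H → R ⊗ Q` with itself: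
`x ⊗ y ↦ φ(x)_{1} φ(y)_{2}`, the two factors being placed in the first and in the second copy
of `Q`. -/
def conv (φ : H →ₗ[k] R ⊗[k] Q) : H ⊗[k] H →ₗ[k] R ⊗[k] (Q ⊗[k] Q) :=
  LinearMap.mul' k (R ⊗[k] (Q ⊗[k] Q)) ∘ₗ TensorProduct.map
    ((Algebra.TensorProduct.map (AlgHom.id k R)
      (Algebra.TensorProduct.includeLeft : Q →ₐ[k] Q ⊗[k] Q)).toLinearMap ∘ₗ φ)
    ((Algebra.TensorProduct.map (AlgHom.id k R)
      (Algebra.TensorProduct.includeRight : Q →ₐ[k] Q ⊗[k] Q)).toLinearMap ∘ₗ φ)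

/-- A linear map `φ : H → R ⊗ Q` is the restriction to `H` of a homomorphism of `R`-bialgebras
`R ⊗ H → R ⊗ Q`. -/
structure IsPoint (φ : H →ₗ[k] R ⊗[k] Q) : Prop where
  map_one : φ 1 = 1
  map_mul : ∀ f g, φ (f * g) = φ f * φ g
  counit : ∀ f, pair R Coalgebra.counit (φ f) = algebraMap k R (Coalgebra.counit f)
  comul : ∀ f, Coalgebra.comul.lTensor R (φ f) = conv φ (Coalgebra.comul f)

/-- Push-forward of coefficients along `g : R → R'`. -/
abbrev push (Q : Type*) [CommRing Q] [Algebra k Q] (g : R →ₐ[k] R') : R ⊗[k] Q →ₐ[k] R' ⊗[k] Q :=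
  Algebra.TensorProduct.map g (AlgHom.id k Q)

theorem conv_push (g : R →ₐ[k] R') (φ : H →ₗ[k] R ⊗[k] Q) (z : H ⊗[k] H) :
    conv ((push Q g).toLinearMap ∘ₗ φ) z =
      push (Q ⊗[k] Q) g (conv φ z) := by
  induction z with
  | zero => simp
  | add x y hx hy => rw [map_add, map_add, map_add, hx, hy]
  | tmul x y =>
    simp only [conv, LinearMap.comp_apply, TensorProduct.map_tmul, LinearMap.mul'_apply,
      AlgHom.toLinearMap_apply, map_mul]
    congr 1 <;> simp only [← AlgHom.comp_apply, ← Algebra.TensorProduct.map_comp] <;> rfl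

theorem lTensor_push (g : R →ₐ[k] R') (z : R ⊗[k] Q) :
    (Coalgebra.comul (R := k) (A := Q)).lTensor R' (push Q g z) =
      push (Q ⊗[k] Q) g ((Coalgebra.comul (R := k) (A := Q)).lTensor R z) := by
  induction z with
  | zero => simp
  | add x y hx hy => simp [hx, hy]
  | tmul x y => simp

theorem pair_push (g : R →ₐ[k] R') (l : Q →ₗ[k] k) (z : R ⊗[k] Q) :
    pair R' l (push Q g z) = g (pair R l z) := pair_map g l z

theorem IsPoint.push {φ : H →ₗ[k] R ⊗[k] Q} (h : IsPoint φ) (g : R →ₐ[k] R') :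
    IsPoint ((OneParam.push Q g).toLinearMap ∘ₗ φ) where
  map_one := by rw [LinearMap.comp_apply, AlgHom.toLinearMap_apply, h.map_one, _root_.map_one]
  map_mul f f' := by
    simp only [LinearMap.comp_apply, AlgHom.toLinearMap_apply, h.map_mul, _root_.map_mul]
  counit f := by
    rw [LinearMap.comp_apply, AlgHom.toLinearMap_apply, pair_push, h.counit, AlgHom.commutes]
  comul f := by
    rw [LinearMap.comp_apply, AlgHom.toLinearMap_apply, lTensor_push, h.comul, conv_push]

/-- The canonical identification `R ⊗ (Q ⊗ Q) = (R ⊗ Q) ⊗_R (R ⊗ Q)`. -/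
def double (R Q : Type*) [CommRing R] [Algebra k R] [CommRing Q] [Algebra k Q] :
    R ⊗[k] (Q ⊗[k] Q) →ₐ[k] (R ⊗[k] Q) ⊗[R] (R ⊗[k] Q) :=
  Algebra.TensorProduct.lift
    ((Algebra.TensorProduct.includeLeft : R ⊗[k] Q →ₐ[R] _).restrictScalars k |>.comp
      Algebra.TensorProduct.includeLeft)
    (Algebra.TensorProduct.lift
      ((Algebra.TensorProduct.includeLeft : R ⊗[k] Q →ₐ[R] _).restrictScalars k |>.comp
        Algebra.TensorProduct.includeRight)
      ((Algebra.TensorProduct.includeRight :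
          R ⊗[k] Q →ₐ[R] (R ⊗[k] Q) ⊗[R] (R ⊗[k] Q)).restrictScalars k |>.comp
        Algebra.TensorProduct.includeRight) fun _ _ => Commute.all _ _)
    fun _ _ => Commute.all _ _

theorem tmul_eq_smul {M : Type*} [AddCommGroup M] [Module k M] (a : R) (x : M) :
    a ⊗ₜ[k] x = a • ((1 : R) ⊗ₜ[k] x) := by
  rw [TensorProduct.smul_tmul', smul_eq_mul, mul_one]

theorem double_tmul (a : R) (x y : Q) :
    double (k := k) R Q (a ⊗ₜ (x ⊗ₜ y)) = (a ⊗ₜ x) ⊗ₜ (1 ⊗ₜ y) := by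
  simp [double]

theorem double_injective : Function.Injective (double (k := k) R Q) := by
  have h : ∀ z, double (k := k) R Q z =
      TensorProduct.AlgebraTensorModule.distribBaseChange k R Q Q z := by
    intro z
    induction z with
    | zero => simp
    | add x y hx hy => rw [map_add, map_add, hx, hy]
    | tmul a w =>
      induction w with
      | zero => simp
      | add x y hx hy => rw [TensorProduct.tmul_add, map_add, map_add, hx, hy]
      | tmul x y =>
        rw [double_tmul, TensorProduct.AlgebraTensorModule.distribBaseChange_tmul]
  intro x y hxy
  rw [h, h] at hxy
  exact (TensorProduct.AlgebraTensorModule.distribBaseChange k R Q Q).injective hxy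

theorem comul_eq_double (z : R ⊗[k] Q) : Coalgebra.comul (R := R) z =
    double R Q ((Coalgebra.comul (R := k) (A := Q)).lTensor R z) := by
  induction z with
  | zero => simp
  | add x y hx hy => simp [hx, hy]
  | tmul a x =>
    rw [TensorProduct.comul_tmul, LinearMap.lTensor_tmul]
    generalize Coalgebra.comul (R := k) x = w
    induction w with
    | zero => simp
    | add x y hx hy => simp only [TensorProduct.tmul_add, map_add, hx, hy]
    | tmul x y =>
      rw [double_tmul, tmul_eq_smul a x, TensorProduct.smul_tmul, ← tmul_eq_smul]
      simp

theorem double_conv (φ : R ⊗[k] H →ₗ[R] R ⊗[k] Q) (w : H ⊗[k] H) :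
    double R Q (conv (φ.restrictScalars k ∘ₗ (TensorProduct.mk k R H 1)) w) =
      TensorProduct.map φ φ (double R H (1 ⊗ₜ w)) := by
  have hl : ∀ z : R ⊗[k] Q, double R Q (Algebra.TensorProduct.map (AlgHom.id k R)
      (Algebra.TensorProduct.includeLeft : Q →ₐ[k] Q ⊗[k] Q) z) = z ⊗ₜ 1 := by
    intro z
    induction z with
    | zero => simp
    | add x y hx hy => simp only [TensorProduct.add_tmul, map_add, hx, hy]
    | tmul a x =>
      rw [Algebra.TensorProduct.map_tmul, Algebra.TensorProduct.includeLeft_apply, double_tmul]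
      rfl
  have hr : ∀ z : R ⊗[k] Q, double R Q (Algebra.TensorProduct.map (AlgHom.id k R)
      (Algebra.TensorProduct.includeRight : Q →ₐ[k] Q ⊗[k] Q) z) = 1 ⊗ₜ z := by
    intro z
    induction z with
    | zero => simp
    | add x y hx hy => simp only [TensorProduct.tmul_add, map_add, hx, hy]
    | tmul a x =>
      rw [Algebra.TensorProduct.map_tmul, Algebra.TensorProduct.includeRight_apply, double_tmul]
      rw [AlgHom.id_apply, tmul_eq_smul a (1 : Q), TensorProduct.smul_tmul, ← tmul_eq_smul]
      rfl
  induction w with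
  | zero => simp
  | add x y hx hy => simp only [TensorProduct.tmul_add, map_add, hx, hy]
  | tmul x y =>
    rw [double_tmul]
    simp only [conv, LinearMap.comp_apply, TensorProduct.map_tmul, LinearMap.mul'_apply,
      AlgHom.toLinearMap_apply, map_mul, hl, hr]
    simp

theorem pair_counit (z : R ⊗[k] Q) : Coalgebra.counit (R := R) z = pair R Coalgebra.counit z := by
  induction z with
  | zero => simp
  | add x y hx hy => simp [hx, hy]
  | tmul a x => simp

/-- The restriction `h ↦ μ(1 ⊗ h)`. -/
def restrict (μ : R ⊗[k] H →ₐc[R] R ⊗[k] Q) : H →ₗ[k] R ⊗[k] Q :=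
  ((μ : R ⊗[k] H →ₐ[R] R ⊗[k] Q).toLinearMap.restrictScalars k) ∘ₗ TensorProduct.mk k R H 1

theorem restrict_apply (μ : R ⊗[k] H →ₐc[R] R ⊗[k] Q) (h : H) : restrict μ h = μ (1 ⊗ₜ h) := rfl

theorem isPoint_restrict (μ : R ⊗[k] H →ₐc[R] R ⊗[k] Q) : IsPoint (restrict μ) where
  map_one := map_one μ
  map_mul f g := by
    simp only [restrict_apply]
    rw [← map_mul, Algebra.TensorProduct.tmul_mul_tmul, mul_one]
  counit f := by
    rw [restrict_apply, ← pair_counit, CoalgHomClass.counit_comp_apply]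
    simp [Algebra.algebraMap_eq_smul_one]
  comul f := by
    apply double_injective
    rw [restrict, double_conv, ← comul_eq_double]
    have h := CoalgHomClass.map_comp_comul_apply μ (1 ⊗ₜ f)
    rw [comul_eq_double, LinearMap.lTensor_tmul] at h
    exact h.symm

/-- The homomorphism of `R`-algebras `R ⊗ H → R ⊗ Q` extending `φ`. -/
def IsPoint.algHom {φ : H →ₗ[k] R ⊗[k] Q} (h : IsPoint φ) : R ⊗[k] H →ₐ[R] R ⊗[k] Q :=
  Algebra.TensorProduct.lift (Algebra.ofId R (R ⊗[k] Q))
    (AlgHom.ofLinearMap φ h.map_one h.map_mul) fun _ _ => Commute.all _ _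

theorem IsPoint.algHom_tmul {φ : H →ₗ[k] R ⊗[k] Q} (h : IsPoint φ) (f : H) :
    h.algHom (1 ⊗ₜ f) = φ f := by
  rw [IsPoint.algHom, Algebra.TensorProduct.lift_tmul, _root_.map_one, one_mul]
  rfl

theorem algHom_ext_one {B : Type*} [CommRing B] [Algebra R B] {f g : R ⊗[k] H →ₐ[R] B}
    (h : ∀ x, f (1 ⊗ₜ x) = g (1 ⊗ₜ x)) : f = g := by
  ext z
  induction z with
  | zero => simp
  | add x y hx hy => simp [hx, hy]
  | tmul a x =>
    rw [tmul_eq_smul a x, map_smul, map_smul, h]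

/-- The homomorphism of `R`-bialgebras `R ⊗ H → R ⊗ Q` extending `φ`. -/
def IsPoint.bialgHom {φ : H →ₗ[k] R ⊗[k] Q} (h : IsPoint φ) : R ⊗[k] H →ₐc[R] R ⊗[k] Q :=
  BialgHom.ofAlgHom h.algHom
    (algHom_ext_one fun x => by
      rw [AlgHom.comp_apply, h.algHom_tmul, Bialgebra.counitAlgHom_apply, pair_counit, h.counit]
      simp [Algebra.algebraMap_eq_smul_one])
    (algHom_ext_one fun x => by
      rw [AlgHom.comp_apply, AlgHom.comp_apply, h.algHom_tmul, Bialgebra.comulAlgHom_apply,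
        Bialgebra.comulAlgHom_apply, comul_eq_double, comul_eq_double, LinearMap.lTensor_tmul,
        h.comul]
      have h1 : φ = h.algHom.toLinearMap.restrictScalars k ∘ₗ TensorProduct.mk k R H 1 := by
        ext x
        exact (h.algHom_tmul x).symm
      conv_rhs => rw [h1]
      rw [double_conv]
      rfl)

theorem IsPoint.bialgHom_tmul {φ : H →ₗ[k] R ⊗[k] Q} (h : IsPoint φ) (f : H) :
    h.bialgHom (1 ⊗ₜ f) = φ f := h.algHom_tmul f

theorem restrict_bialgHom {φ : H →ₗ[k] R ⊗[k] Q} (h : IsPoint φ) : restrict h.bialgHom = φ :=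
  LinearMap.ext fun f => h.algHom_tmul f

theorem restrict_injective :
    Function.Injective (restrict : (R ⊗[k] H →ₐc[R] R ⊗[k] Q) → H →ₗ[k] R ⊗[k] Q) := by
  intro μ ν h
  have h1 : (μ : R ⊗[k] H →ₐ[R] R ⊗[k] Q) = ν :=
    algHom_ext_one fun x => LinearMap.congr_fun h x
  ext z
  exact congr($h1 z)

end Points

section Universal

variable (k : Type*) [Field k] (p r : ℕ) [Fact p.Prime] [CharP k p]
  (H : Type*) [CommRing H] [Bialgebra k H]
  (R : Type*) [CommRing R] [Algebra k R] {R' : Type*} [CommRing R'] [Algebra k R']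

/-- The one-parameter subgroups of height `r` over `R` of the affine group scheme `G = Spec H`: the
homomorphisms of `R`-group schemes `𝔾_{a(r),R} → G_R`, given by the corresponding homomorphisms of
`R`-bialgebras `R ⊗ k[G] → R ⊗ k[𝔾_{a(r)}]`. -/
abbrev Subgp : Type _ := R ⊗[k] H →ₐc[R] R ⊗[k] GaCoord k p r

variable {k p r H R}

/-- Base change of a one-parameter subgroup along `g : R → R'`: on `1 ⊗ f` it is the image of
`μ(1 ⊗ f)` under `g ⊗ id`, see `baseChange_tmul`. -/
def baseChange (g : R →ₐ[k] R') (μ : Subgp k p r H R) : Subgp k p r H R' :=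
  ((isPoint_restrict μ).push g).bialgHom

theorem baseChange_tmul (g : R →ₐ[k] R') (μ : Subgp k p r H R) (f : H) :
    baseChange g μ (1 ⊗ₜ f) = Algebra.TensorProduct.map g (AlgHom.id k _) (μ (1 ⊗ₜ f)) :=
  IsPoint.bialgHom_tmul _ f

set_option linter.unusedSectionVars false in
variable (p r) in
theorem scale_aux (c : R) : (c ⊗ₜ[k] GaCoord.T k p r) ^ p ^ r = 0 := by
  rw [Algebra.TensorProduct.tmul_pow, GaCoord.T_pow, TensorProduct.tmul_zero]

variable (k p r) in
theorem scale_isPoint (c : R) :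
    IsPoint (GaCoord.lift (c ⊗ₜ[k] GaCoord.T k p r) (scale_aux p r c)).toLinearMap where
  map_one := map_one (GaCoord.lift (c ⊗ₜ[k] GaCoord.T k p r) (scale_aux p r c))
  map_mul := map_mul (GaCoord.lift (c ⊗ₜ[k] GaCoord.T k p r) (scale_aux p r c))
  counit f := by
    have h : (((Bialgebra.counitAlgHom R (R ⊗[k] GaCoord k p r)).restrictScalars k).comp
        (GaCoord.lift (c ⊗ₜ[k] GaCoord.T k p r) (scale_aux p r c))) =
        (Algebra.ofId k R).comp (Bialgebra.counitAlgHom k (GaCoord k p r)) := by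
      apply GaCoord.hom_ext
      have := GaCoord.counitAlgHom_T k p r
      rw [Bialgebra.counitAlgHom_apply] at this
      simp [this]
    have := congr($h f)
    rw [← pair_counit]
    exact this
  comul f := by
    have h : (Algebra.TensorProduct.map (AlgHom.id k R)
          (Bialgebra.comulAlgHom k (GaCoord k p r))).comp
        (GaCoord.lift (c ⊗ₜ[k] GaCoord.T k p r) (scale_aux p r c)) =
        (Algebra.TensorProduct.lift
          ((Algebra.TensorProduct.map (AlgHom.id k R) Algebra.TensorProduct.includeLeft).comp
            (GaCoord.lift (c ⊗ₜ[k] GaCoord.T k p r) (scale_aux p r c)))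
          ((Algebra.TensorProduct.map (AlgHom.id k R) Algebra.TensorProduct.includeRight).comp
            (GaCoord.lift (c ⊗ₜ[k] GaCoord.T k p r) (scale_aux p r c)))
          fun _ _ => Commute.all _ _).comp (Bialgebra.comulAlgHom k (GaCoord k p r)) := by
      apply GaCoord.hom_ext
      simp only [AlgHom.comp_apply, GaCoord.lift_T, GaCoord.comulAlgHom_T, map_add,
        Algebra.TensorProduct.map_tmul, Algebra.TensorProduct.lift_tmul, map_one, mul_one, one_mul,
        TensorProduct.tmul_add, AlgHom.id_apply, Algebra.TensorProduct.includeLeft_apply,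
        Algebra.TensorProduct.includeRight_apply]
    have h1 := congr($h f)
    refine Eq.trans h1 ?_
    simp only [AlgHom.comp_apply, Bialgebra.comulAlgHom_apply]
    generalize Coalgebra.comul (R := k) f = w
    induction w with
    | zero => simp
    | add x y hx hy => rw [map_add, map_add, hx, hy]
    | tmul x y => rfl

variable (k p r) in
/-- Multiplication by `c ∈ R` on `𝔾_{a(r),R}`, given by the homomorphism `T ↦ c T` of
`R`-bialgebras. -/
def scale (c : R) : R ⊗[k] GaCoord k p r →ₐc[R] R ⊗[k] GaCoord k p r :=
  (scale_isPoint k p r c).bialgHom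

theorem scale_T (c : R) : scale k p r c (1 ⊗ₜ GaCoord.T k p r) = c ⊗ₜ GaCoord.T k p r :=
  ((scale_isPoint k p r c).bialgHom_tmul _).trans (GaCoord.lift_T _ (scale_aux p r c))

/-- The action of `c ∈ R = 𝔸¹(R)` on one-parameter subgroups: precomposition of
`𝔾_{a(r),R} → G_R` with multiplication by `c` on `𝔾_{a(r),R}`. -/
def act (c : R) (μ : Subgp k p r H R) : Subgp k p r H R := (scale k p r c).comp μ

variable (k p r H)

/-- The polynomial algebra over `k` on symbols `x_i(f)`, `k`-linear in `f ∈ H = k[G]`,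
where `0 ≤ i < p^r`. -/
abbrev Gen : Type _ := SymmetricAlgebra k (Fin (p ^ r) → H)

/-- The generic linear map `f ↦ ∑ i, x_i(f) ⊗ T^i`. -/
def genMap : H →ₗ[k] Gen k p r H ⊗[k] GaCoord k p r :=
  ∑ i, (TensorProduct.mk k (Gen k p r H) (GaCoord k p r)).flip (GaCoord.basis k p r i) ∘ₗ
    SymmetricAlgebra.ι k (Fin (p ^ r) → H) ∘ₗ LinearMap.single k (fun _ => H) i

/-- The equations which express that the generic linear map is unital, multiplicative, and
compatible with counits and comultiplications. -/
def relations : Set (Gen k p r H) :=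
  {s | ∃ l : GaCoord k p r →ₗ[k] k, s = pair _ l (genMap k p r H 1 - 1)} ∪
  {s | ∃ (l : GaCoord k p r →ₗ[k] k) (f g : H),
    s = pair _ l (genMap k p r H (f * g) - genMap k p r H f * genMap k p r H g)} ∪
  {s | ∃ f : H, s = pair _ Coalgebra.counit (genMap k p r H f) -
    algebraMap k (Gen k p r H) (Coalgebra.counit f)} ∪
  {s | ∃ (l : GaCoord k p r ⊗[k] GaCoord k p r →ₗ[k] k) (f : H),
    s = pair _ l (Coalgebra.comul.lTensor (Gen k p r H) (genMap k p r H f) -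
      conv (genMap k p r H) (Coalgebra.comul f))}

/-- The coordinate algebra `k[V_r(G)]` of the scheme of one-parameter subgroups of height `r` of
`G = Spec H`. It represents the functor of one-parameter subgroups, see
`existsUnique_baseChange_univ`. -/
def Coord : Type _ := Gen k p r H ⧸ Ideal.span (relations k p r H)

instance : CommRing (Coord k p r H) :=
  inferInstanceAs (CommRing (Gen k p r H ⧸ Ideal.span (relations k p r H)))

instance : Algebra k (Coord k p r H) :=
  inferInstanceAs (Algebra k (Gen k p r H ⧸ Ideal.span (relations k p r H)))

/-- The quotient map onto `k[V_r(G)]`. -/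
def Coord.mk : Gen k p r H →ₐ[k] Coord k p r H :=
  Ideal.Quotient.mkₐ k (Ideal.span (relations k p r H))

variable {k p r H}

theorem Coord.mk_surjective : Function.Surjective (Coord.mk k p r H) :=
  Ideal.Quotient.mkₐ_surjective k (Ideal.span (relations k p r H))

theorem Coord.mk_eq_zero {s : Gen k p r H} (h : s ∈ relations k p r H) :
    Coord.mk k p r H s = 0 :=
  Ideal.Quotient.eq_zero_iff_mem.2 (Ideal.subset_span h)

/-- A homomorphism from the polynomial algebra annihilating the relations factors through
`k[V_r(G)]`. -/
def Coord.lift (g : Gen k p r H →ₐ[k] R) (h : ∀ s ∈ relations k p r H, g s = 0) :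
    Coord k p r H →ₐ[k] R :=
  Ideal.Quotient.liftₐ (Ideal.span (relations k p r H)) g fun a ha => by
    have : Ideal.span (relations k p r H) ≤ RingHom.ker g := Ideal.span_le.2 h
    exact this ha

theorem Coord.lift_mk (g : Gen k p r H →ₐ[k] R) (h : ∀ s ∈ relations k p r H, g s = 0)
    (s : Gen k p r H) : Coord.lift g h (Coord.mk k p r H s) = g s := rfl

theorem push_eq_of_pair {V : Type*} [CommRing V] [Algebra k V] (g : R →ₐ[k] R') {x y : R ⊗[k] V}
    (h : ∀ l : V →ₗ[k] k, g (pair R l (x - y)) = 0) : push V g x = push V g y := by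
  rw [← sub_eq_zero, ← map_sub]
  refine eq_zero_of_pair _ fun l => ?_
  rw [← h l]
  exact pair_map g l (x - y)

theorem isPoint_mk : IsPoint ((push (GaCoord k p r) (Coord.mk k p r H)).toLinearMap ∘ₗ
    genMap k p r H) where
  map_one := by
    rw [← map_one (push (GaCoord k p r) (Coord.mk k p r H))]
    exact push_eq_of_pair _ fun l => Coord.mk_eq_zero (.inl (.inl (.inl ⟨l, rfl⟩)))
  map_mul f g := by
    simp only [LinearMap.comp_apply, AlgHom.toLinearMap_apply]
    rw [← map_mul]
    exact push_eq_of_pair _ fun l => Coord.mk_eq_zero (.inl (.inl (.inr ⟨l, f, g, rfl⟩)))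
  counit f := by
    rw [LinearMap.comp_apply, AlgHom.toLinearMap_apply, pair_push, ← sub_eq_zero,
      ← (Coord.mk k p r H).commutes, ← map_sub]
    exact Coord.mk_eq_zero (.inl (.inr ⟨f, rfl⟩))
  comul f := by
    rw [LinearMap.comp_apply, AlgHom.toLinearMap_apply, lTensor_push, conv_push]
    exact push_eq_of_pair _ fun l => Coord.mk_eq_zero (.inr ⟨l, f, rfl⟩)

variable (k p r H) in
/-- The universal one-parameter subgroup of height `r`, defined over `k[V_r(G)]`. -/
def univ : Subgp k p r H (Coord k p r H) := (isPoint_mk (k := k) (p := p) (r := r)).bialgHom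

/-- The homomorphism assigning to `x_i(f)` the coefficient of `T^i` in `μ(1 ⊗ f)`. -/
def classifyGen (μ : Subgp k p r H R) : Gen k p r H →ₐ[k] R :=
  SymmetricAlgebra.lift (∑ i, ((pair R ((GaCoord.basis k p r).coord i)).restrictScalars k) ∘ₗ
    restrict μ ∘ₗ LinearMap.proj i)

theorem sum_pair_basis {V ι : Type*} [AddCommGroup V] [Module k V] [Fintype ι]
    (b : Module.Basis ι k V) (z : R ⊗[k] V) : ∑ i, pair R (b.coord i) z ⊗ₜ b i = z := by
  induction z with
  | zero => simp
  | add x y hx hy => simp only [map_add, TensorProduct.add_tmul, Finset.sum_add_distrib, hx, hy]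
  | tmul a v =>
    simp only [pair_tmul, TensorProduct.smul_tmul, ← TensorProduct.tmul_sum,
      Module.Basis.coord_apply, b.sum_repr]

set_option linter.unusedSectionVars false in
theorem push_genMap (g : Gen k p r H →ₐ[k] R) (f : H) :
    push (GaCoord k p r) g (genMap k p r H f) =
      ∑ i, g (SymmetricAlgebra.ι k _ (Pi.single i f)) ⊗ₜ GaCoord.basis k p r i := by
  simp [genMap]

theorem push_classifyGen (μ : Subgp k p r H R) :
    (push (GaCoord k p r) (classifyGen μ)).toLinearMap ∘ₗ genMap k p r H = restrict μ := by
  ext f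
  rw [LinearMap.comp_apply, AlgHom.toLinearMap_apply, push_genMap,
    ← sum_pair_basis (GaCoord.basis k p r) (restrict μ f)]
  refine Finset.sum_congr rfl fun i _ => ?_
  congr 1
  rw [classifyGen, SymmetricAlgebra.lift_ι_apply, LinearMap.sum_apply,
    Finset.sum_eq_single i]
  · simp
  · intro j _ hj
    simp [Pi.single_eq_of_ne hj]
  · simp

theorem classifyGen_eq_zero (μ : Subgp k p r H R) (s : Gen k p r H)
    (hs : s ∈ relations k p r H) : classifyGen μ s = 0 := by
  have hμ := isPoint_restrict μ
  rw [← push_classifyGen] at hμ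
  have key : ∀ {V : Type _} [CommRing V] [Algebra k V] (l : V →ₗ[k] k)
      (x y : Gen k p r H ⊗[k] V), push V (classifyGen μ) x = push V (classifyGen μ) y →
      classifyGen μ (pair _ l (x - y)) = 0 := by
    intro V _ _ l x y hxy
    have h := pair_map (classifyGen μ) l (x - y)
    rw [← h]
    have h' : push V (classifyGen μ) (x - y) = 0 := by rw [map_sub, hxy, sub_self]
    exact (congrArg (pair R l) h').trans (map_zero _)
  rcases hs with ((⟨l, rfl⟩ | ⟨l, f, g, rfl⟩) | ⟨f, rfl⟩) | ⟨l, f, rfl⟩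
  · exact key _ _ _ (hμ.map_one.trans (map_one _).symm)
  · exact key _ _ _ ((hμ.map_mul f g).trans
      (map_mul (push (GaCoord k p r) (classifyGen μ)) _ _).symm)
  · have h := hμ.counit f
    rw [LinearMap.comp_apply, AlgHom.toLinearMap_apply, pair_push] at h
    rw [map_sub, h, AlgHom.commutes, sub_self]
  · have h := hμ.comul f
    rw [LinearMap.comp_apply, AlgHom.toLinearMap_apply, lTensor_push, conv_push] at h
    exact key _ _ _ h

/-- The homomorphism `k[V_r(G)] → R` corresponding to a one-parameter subgroup over `R`. -/
def classify (μ : Subgp k p r H R) : Coord k p r H →ₐ[k] R :=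
  Coord.lift (classifyGen μ) (classifyGen_eq_zero μ)

theorem restrict_baseChange_univ (g : Coord k p r H →ₐ[k] R) :
    restrict (baseChange g (univ k p r H)) =
      (push (GaCoord k p r) (g.comp (Coord.mk k p r H))).toLinearMap ∘ₗ genMap k p r H := by
  rw [baseChange, restrict_bialgHom, univ, restrict_bialgHom]
  ext f
  simp only [LinearMap.comp_apply, AlgHom.toLinearMap_apply]
  rw [← AlgHom.comp_apply, ← Algebra.TensorProduct.map_comp]
  rfl

theorem baseChange_classify (μ : Subgp k p r H R) :
    baseChange (classify μ) (univ k p r H) = μ := by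
  apply restrict_injective
  rw [restrict_baseChange_univ]
  exact push_classifyGen μ

/-- `k[V_r(G)]` represents the functor of one-parameter subgroups of height `r` of `G`, with
`univ` as universal object: every one-parameter subgroup over `R` is the base change of `univ`
along a unique homomorphism `k[V_r(G)] → R`. -/
theorem existsUnique_baseChange_univ (μ : Subgp k p r H R) :
    ∃! g : Coord k p r H →ₐ[k] R, baseChange g (univ k p r H) = μ := by
  refine ⟨classify μ, baseChange_classify μ, fun g hg => ?_⟩
  have h : ∀ f, push (GaCoord k p r) (g.comp (Coord.mk k p r H)) (genMap k p r H f) =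
      push (GaCoord k p r) ((classify μ).comp (Coord.mk k p r H)) (genMap k p r H f) := by
    intro f
    have h1 := restrict_baseChange_univ g
    have h2 := restrict_baseChange_univ (classify μ)
    rw [baseChange_classify] at h2
    rw [hg, h2] at h1
    exact (LinearMap.congr_fun h1 f).symm
  have h' : g.comp (Coord.mk k p r H) = (classify μ).comp (Coord.mk k p r H) := by
    apply SymmetricAlgebra.algHom_ext
    refine LinearMap.pi_ext fun i f => ?_
    have h3 := congrArg (pair R ((GaCoord.basis k p r).coord i)) (h f)
    rw [push_genMap, push_genMap, map_sum, map_sum] at h3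
    simpa [Finsupp.single_apply] using h3
  ext a
  obtain ⟨s, rfl⟩ := Coord.mk_surjective a
  exact congr($h' s)

variable (k p r H)

/-- The coaction `k[V_r(G)] → k[V_r(G)] ⊗ k[t] = k[V_r(G)][t]` of the action
`V_r(G) × 𝔸¹ → V_r(G)`, `(μ, c) ↦ μ ∘ (multiplication by c)`: it corresponds to the one-parameter
subgroup over `k[V_r(G)][t]` obtained by letting `t` act on the universal one. -/
def coaction : Coord k p r H →ₐ[k] (Coord k p r H)[X] :=
  classify (act Polynomial.X (baseChange Polynomial.CAlgHom (univ k p r H)))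

/-- The homogeneous summand of degree `n` of `k[V_r(G)]`: the `a` whose coaction is `a ⊗ t^n`. -/
def homog (n : ℕ) : Submodule k (Coord k p r H) :=
  LinearMap.eqLocus (coaction k p r H).toLinearMap
    ((Polynomial.monomial n : Coord k p r H →ₗ[Coord k p r H] _).restrictScalars k)

theorem mem_homog {n : ℕ} {a : Coord k p r H} : a ∈ homog k p r H n ↔
    coaction k p r H a = Polynomial.monomial n a := Iff.rfl

/-- The linear functional `u_{r-1}` on `k[𝔾_{a(r)}]`, dual to `T^{p^{r-1}}`. -/
def uTop (hr : 0 < r) : Module.Dual k (GaCoord k p r) :=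
  (GaCoord.basis k p r).coord ⟨p ^ (r - 1), Nat.pow_lt_pow_right (Fact.out : p.Prime).one_lt
    (Nat.sub_lt hr one_pos)⟩

/-- The global `p`-nilpotent operator `Θ_{G,r} : k[G] → k[V_r(G)]`, the composite of
`f ↦ 1 ⊗ f`, of the universal one-parameter subgroup and of `id ⊗ u_{r-1}`. -/
def theta (hr : 0 < r) : H →ₗ[k] Coord k p r H :=
  (pair (Coord k p r H) (uTop k p r hr)).restrictScalars k ∘ₗ
    ((univ k p r H : Coord k p r H ⊗[k] H →ₐ[Coord k p r H]
      Coord k p r H ⊗[k] GaCoord k p r).toLinearMap.restrictScalars k) ∘ₗ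
    TensorProduct.mk k (Coord k p r H) H 1

variable {k p r H} in
/-- The map `k𝔾_{a(r)} ⊗ R → kG ⊗ R` on group algebras induced by a one-parameter subgroup `μ` over
`R`, for finite `G`. The group algebra is the dual of the coordinate algebra, and `kG ⊗ R` is
identified with the `R`-linear forms on `R ⊗ k[G]`; the map is precomposition with
`R ⊗ k[G] → R ⊗ k[𝔾_{a(r)}]`. -/
def groupAlgebraMap [Module.Finite k H] (μ : Subgp k p r H R) :
    Module.Dual k (GaCoord k p r) ⊗[k] R →ₗ[k] Module.Dual k H ⊗[k] R :=
  (dualTensorHomEquiv k H R).symm.toLinearMap ∘ₗ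
    ((LinearMap.liftBaseChangeEquiv R).symm.toLinearMap.restrictScalars k) ∘ₗ
    ((LinearMap.lcomp R R (μ : R ⊗[k] H →ₐ[R] R ⊗[k] GaCoord k p r).toLinearMap).restrictScalars
      k) ∘ₗ
    ((LinearMap.liftBaseChangeEquiv R).toLinearMap.restrictScalars k) ∘ₗ
    dualTensorHom k (GaCoord k p r) R

end Universal
end OneParam

end

namespace OneParam

/-! Write the universal subgroup as `1 ⊗ f ↦ ∑ a_i(f) ⊗ T^i`, where `a_i` is `univCoeff i`.
Multiplication by `t` replaces `T` by `tT`, so the coaction sends `a_i(f)` to `a_i(f) t^i`: each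
`a_i(f)` is homogeneous of degree `i` (`coaction_univCoeff`). Since `Θ` is `a_i` for `i = p^(r-1)`,
claim (1) follows.

The `a_i(f)` generate `k[V_r(G)]`, so the homogeneous summands span it. Their sum is direct because
the coefficient of `t^n` in the coaction of a sum of homogeneous elements is its component of degree
`n` (`coeff_coaction_coe`).

That degrees `p^i` suffice for generation comes from the divided-power structure of the dual of
`k[𝔾_{a(r)}]`. Compatibility with comultiplication says that `(i+j choose i) a_{i+j}` is the
convolution product of `a_i` and `a_j` (`choose_smul_univCoeff`). Taking for `i` the leading power
of `p` in `n = i + j` makes the binomial coefficient invertible in `k`, so `a_n` is expressed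
through coefficients of smaller index unless `n` is itself a power of `p`; the induction ends at
`a_0`, the counit.

For (2), under `kG ⊗ R = Hom(k[G], R)` the image of `u_{r-1} ⊗ 1` is the map `Θ` itself. What
remains is linear algebra: for finite-dimensional `V`, a map from `V` to `R` takes values in a
subspace `W` exactly when its tensor is a sum of `x_i ⊗ a_i` with `a_i` in `W`. -/

/-! ### Binomial coefficients modulo a prime -/

theorem choose_prime_pow_modEq (p : ℕ) [Fact p.Prime] (j n : ℕ) :
    n.choose (p ^ j) ≡ n / p ^ j [MOD p] := by
  have hp : p.Prime := Fact.out
  induction j generalizing n with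
  | zero => simp [Nat.ModEq.refl]
  | succ j ih =>
    -- Lucas' congruence strips the lowest base-`p` digit. That digit of `p^(j+1)` is 0, so it
    -- contributes the factor 1.
    refine Choose.choose_modEq_choose_mod_mul_choose_div_nat.trans ?_
    have h1 : p ^ (j + 1) % p = 0 := Nat.mod_eq_zero_of_dvd (dvd_pow_self p j.succ_ne_zero)
    have h2 : p ^ (j + 1) / p = p ^ j := by
      rw [pow_succ, Nat.mul_div_cancel _ hp.pos]
    rw [h1, h2, Nat.choose_zero_right, one_mul, pow_succ', ← Nat.div_div_eq_div_mul]
    exact ih _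

/-- The binomial coefficient of `n` over the leading power of `p` in `n` is prime to `p`. -/
theorem not_dvd_choose_pow_log (p : ℕ) [Fact p.Prime] {n : ℕ} (hn : n ≠ 0) :
    ¬ p ∣ n.choose (p ^ Nat.log p n) := by
  have hp : p.Prime := Fact.out
  rw [(choose_prime_pow_modEq p (Nat.log p n) n).dvd_iff dvd_rfl]
  -- The quotient is the leading base-`p` digit of `n`, hence lies strictly between 0 and `p`.
  refine Nat.not_dvd_of_pos_of_lt (Nat.div_pos (Nat.pow_log_le_self p hn) (pow_pos hp.pos _)) ?_
  rw [Nat.div_lt_iff_lt_mul (pow_pos hp.pos _), ← pow_succ']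
  exact Nat.lt_pow_succ_log_self hp.one_lt n

/-! ### Contracting convolutions with functionals -/

section Coefficients

variable {k : Type*} [Field k] {R : Type*} [CommRing R] [Algebra k R]
  {Q : Type*} [CommRing Q] [Bialgebra k Q] {H : Type*} [CommRing H] [Bialgebra k H]

/-- The linear functional `x ⊗ y ↦ l(x) l'(y)`. -/
def tensorFunctional (l l' : Q →ₗ[k] k) : Q ⊗[k] Q →ₗ[k] k :=
  LinearMap.mul' k k ∘ₗ TensorProduct.map l l'

@[simp]
theorem tensorFunctional_tmul (l l' : Q →ₗ[k] k) (x y : Q) :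
    tensorFunctional l l' (x ⊗ₜ y) = l x * l' y := rfl

theorem pair_mul_include (l l' : Q →ₗ[k] k) (z z' : R ⊗[k] Q) :
    pair R (tensorFunctional l l')
      (Algebra.TensorProduct.map (AlgHom.id k R)
        (Algebra.TensorProduct.includeLeft : Q →ₐ[k] Q ⊗[k] Q) z *
      Algebra.TensorProduct.map (AlgHom.id k R)
        (Algebra.TensorProduct.includeRight : Q →ₐ[k] Q ⊗[k] Q) z') =
      pair R l z * pair R l' z' := by
  induction z with
  | zero => simp
  | add x y hx hy => simp only [map_add, add_mul, hx, hy]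
  | tmul a x =>
    induction z' with
    | zero => simp
    | add x y hx hy => simp only [map_add, mul_add, hx, hy]
    | tmul b y => simp [smul_smul, mul_comm]

/-- `conv` places its two factors in different copies of `Q`, so a product functional evaluates them
independently. This turns compatibility with comultiplication into identities between coefficients
in `R`. -/
theorem pair_conv (l l' : Q →ₗ[k] k) (φ : H →ₗ[k] R ⊗[k] Q) (w : H ⊗[k] H) :
    pair R (tensorFunctional l l') (conv φ w) =
      LinearMap.mul' k R (TensorProduct.map ((pair R l).restrictScalars k ∘ₗ φ)
        ((pair R l').restrictScalars k ∘ₗ φ) w) := by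
  induction w with
  | zero => simp
  | add x y hx hy => simp only [map_add, hx, hy]
  | tmul x y => exact pair_mul_include l l' (φ x) (φ y)

theorem pair_lTensor {V W : Type*} [AddCommGroup V] [Module k V] [AddCommGroup W] [Module k W]
    (l : W →ₗ[k] k) (g : V →ₗ[k] W) (z : R ⊗[k] V) :
    pair R l (g.lTensor R z) = pair R (l ∘ₗ g) z := by
  induction z with
  | zero => simp
  | add x y hx hy => simp only [map_add, hx, hy]
  | tmul a v => simp

theorem mul'_map_mem {V W : Type*} [AddCommGroup V] [Module k V] [AddCommGroup W] [Module k W]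
    (S : Subalgebra k R) {f : V →ₗ[k] R} {g : W →ₗ[k] R} (hf : ∀ v, f v ∈ S) (hg : ∀ w, g w ∈ S)
    (z : V ⊗[k] W) : LinearMap.mul' k R (TensorProduct.map f g z) ∈ S := by
  induction z with
  | zero => simp
  | add x y hx hy => rw [map_add, map_add]; exact add_mem hx hy
  | tmul v w => exact mul_mem (hf v) (hg w)

end Coefficients

/-! ### The dual of `k[𝔾_{a(r)}]` as a divided power algebra -/

section Ga

variable (k : Type*) [Field k] (p r : ℕ) [Fact p.Prime] [CharP k p]

theorem GaCoord.comul_T_pow (m : ℕ) :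
    Coalgebra.comul (R := k) (GaCoord.T k p r ^ m) =
      ∑ a ∈ Finset.range (m + 1),
        (m.choose a : k) • ((GaCoord.T k p r ^ a) ⊗ₜ[k] (GaCoord.T k p r ^ (m - a))) := by
  rw [← Bialgebra.comulAlgHom_apply, map_pow, GaCoord.comulAlgHom_T, add_pow]
  refine Finset.sum_congr rfl fun a _ => ?_
  rw [Algebra.TensorProduct.tmul_pow, Algebra.TensorProduct.tmul_pow,
    Algebra.TensorProduct.tmul_mul_tmul, one_pow, one_pow, one_mul, mul_one, Nat.cast_smul_eq_nsmul,
    nsmul_eq_mul, mul_comm]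

set_option linter.unusedSectionVars false in
theorem GaCoord.coord_T_pow (i : Fin (p ^ r)) {m : ℕ} (hm : m < p ^ r) :
    (GaCoord.basis k p r).coord i (GaCoord.T k p r ^ m) = if m = i then 1 else 0 := by
  rw [← GaCoord.basis_apply k p r ⟨m, hm⟩, Module.Basis.coord_apply, Module.Basis.repr_self,
    Finsupp.single_apply]
  simp [Fin.ext_iff]

/-- The divided-power rule for the dual basis: by the binomial theorem, `T^i ⊗ T^j` occurs in the
comultiplication of `T^m` only for `m = i + j`. Having `n` in `Fin (p ^ r)` keeps `i + j` below
`p^r`. -/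
theorem GaCoord.tensorFunctional_comul (i j n : Fin (p ^ r)) (hn : (n : ℕ) = i + j) :
    tensorFunctional ((GaCoord.basis k p r).coord i) ((GaCoord.basis k p r).coord j) ∘ₗ
      Coalgebra.comul = ((n : ℕ).choose i : k) • (GaCoord.basis k p r).coord n := by
  refine (GaCoord.basis k p r).ext fun m => ?_
  rw [LinearMap.smul_apply, GaCoord.basis_apply, GaCoord.coord_T_pow k p r n m.2,
    LinearMap.comp_apply, GaCoord.comul_T_pow, map_sum]
  have h : ∀ a ∈ Finset.range ((m : ℕ) + 1),
      tensorFunctional ((GaCoord.basis k p r).coord i) ((GaCoord.basis k p r).coord j)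
        (((m : ℕ).choose a : k) • ((GaCoord.T k p r ^ a) ⊗ₜ[k] (GaCoord.T k p r ^ ((m : ℕ) - a)))) =
      if a = i ∧ (m : ℕ) = n then ((n : ℕ).choose i : k) else 0 := by
    intro a ha
    have ha' : a ≤ m := Nat.lt_succ_iff.1 (Finset.mem_range.1 ha)
    rw [map_smul, tensorFunctional_tmul, GaCoord.coord_T_pow k p r i (ha'.trans_lt m.2),
      GaCoord.coord_T_pow k p r j ((Nat.sub_le _ _).trans_lt m.2)]
    by_cases h1 : a = i
    · by_cases h2 : (m : ℕ) = n
      · have h3 : (m : ℕ) - a = j := by omega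
        rw [if_pos h1, if_pos h3, if_pos ⟨h1, h2⟩, h1, h2]
        simp
      · have h3 : (m : ℕ) - a ≠ j := by omega
        rw [if_neg h3, if_neg (not_and_of_not_right _ h2), mul_zero, smul_zero]
    · rw [if_neg h1, if_neg (not_and_of_not_left _ h1), zero_mul, smul_zero]
  rw [Finset.sum_congr rfl h]
  by_cases h2 : (m : ℕ) = n
  · have h4 : (i : ℕ) ≤ m := by omega
    simp [h2, hn]
  · simp [h2]

end Ga

/-! ### Coefficients of the universal subgroup and their degrees -/

section Grading

variable (k : Type*) [Field k] (p r : ℕ) [Fact p.Prime] [CharP k p]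
  (H : Type*) [CommRing H] [Bialgebra k H]

/-- The coefficient of `T^i` in the universal one-parameter subgroup. -/
def univCoeff (i : Fin (p ^ r)) : H →ₗ[k] Coord k p r H :=
  (Coord.mk k p r H).toLinearMap ∘ₗ SymmetricAlgebra.ι k (Fin (p ^ r) → H) ∘ₗ
    LinearMap.single k (fun _ => H) i

variable {k p r H}

theorem univ_tmul (f : H) : univ k p r H (1 ⊗ₜ f) =
    ∑ i, univCoeff k p r H i f ⊗ₜ GaCoord.basis k p r i :=
  (IsPoint.bialgHom_tmul _ f).trans (push_genMap _ f)

set_option linter.unusedSectionVars false in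
theorem pair_coord_sum {R : Type*} [CommRing R] [Algebra k R] (i : Fin (p ^ r))
    (c : Fin (p ^ r) → R) :
    pair R ((GaCoord.basis k p r).coord i) (∑ j, c j ⊗ₜ GaCoord.basis k p r j) = c i := by
  rw [map_sum, Finset.sum_eq_single i]
  · simp
  · intro j _ hj
    simp [hj]
  · simp

theorem pair_univ (i : Fin (p ^ r)) (f : H) :
    pair _ ((GaCoord.basis k p r).coord i) (univ k p r H (1 ⊗ₜ f)) = univCoeff k p r H i f := by
  rw [univ_tmul, pair_coord_sum]

theorem univCoeff_eq_comp (i : Fin (p ^ r)) : univCoeff k p r H i =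
    (pair _ ((GaCoord.basis k p r).coord i)).restrictScalars k ∘ₗ restrict (univ k p r H) :=
  LinearMap.ext fun f => (pair_univ i f).symm

/-- The universal subgroup pulls back to `μ` along `classify μ`, so its coefficients specialize to
those of `μ`. -/
theorem classify_univCoeff {R : Type*} [CommRing R] [Algebra k R] (μ : Subgp k p r H R)
    (i : Fin (p ^ r)) (f : H) : classify μ (univCoeff k p r H i f) =
      pair R ((GaCoord.basis k p r).coord i) (μ (1 ⊗ₜ f)) := by
  rw [← pair_univ, ← pair_push, ← baseChange_tmul, baseChange_classify]

theorem scale_basis {R : Type*} [CommRing R] [Algebra k R] (c a : R) (i : Fin (p ^ r)) :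
    scale k p r c (a ⊗ₜ GaCoord.basis k p r i) = (a * c ^ (i : ℕ)) ⊗ₜ GaCoord.basis k p r i := by
  have h : (1 : R) ⊗ₜ[k] (GaCoord.T k p r ^ (i : ℕ)) = (1 ⊗ₜ GaCoord.T k p r) ^ (i : ℕ) := by
    rw [Algebra.TensorProduct.tmul_pow, one_pow]
  rw [GaCoord.basis_apply, tmul_eq_smul, map_smul, h, map_pow, scale_T,
    Algebra.TensorProduct.tmul_pow, TensorProduct.smul_tmul', smul_eq_mul]

/-- The source of all homogeneity: `T ↦ tT` multiplies the coefficient of `T^i` by `t^i`. -/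
theorem coaction_univCoeff (i : Fin (p ^ r)) (f : H) :
    coaction k p r H (univCoeff k p r H i f) =
      Polynomial.monomial (i : ℕ) (univCoeff k p r H i f) := by
  have h : act Polynomial.X (baseChange Polynomial.CAlgHom (univ k p r H)) (1 ⊗ₜ f) =
      ∑ j, (Polynomial.C (univCoeff k p r H j f) * Polynomial.X ^ (j : ℕ)) ⊗ₜ
        GaCoord.basis k p r j := by
    refine Eq.trans (congrArg (scale k p r (Polynomial.X : (Coord k p r H)[X]))
      (baseChange_tmul Polynomial.CAlgHom (univ k p r H) f)) ?_
    rw [univ_tmul, map_sum, map_sum]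
    refine Finset.sum_congr rfl fun j _ => ?_
    rw [Algebra.TensorProduct.map_tmul, AlgHom.id_apply, scale_basis]
    rfl
  rw [coaction, classify_univCoeff, h, pair_coord_sum, Polynomial.C_mul_X_pow_eq_monomial]

theorem univCoeff_mem_homog (i : Fin (p ^ r)) (f : H) :
    univCoeff k p r H i f ∈ homog k p r H i :=
  (mem_homog k p r H).2 (coaction_univCoeff i f)

/-- The functional dual to `T^0` is the counit of `k[𝔾_{a(r)}]`, and the universal subgroup respects
counits. -/
theorem univCoeff_zero (i : Fin (p ^ r)) (hi : (i : ℕ) = 0) (f : H) :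
    univCoeff k p r H i f = algebraMap k _ (Coalgebra.counit f) := by
  have h : (GaCoord.basis k p r).coord i = Coalgebra.counit := by
    refine (GaCoord.basis k p r).ext fun m => ?_
    rw [GaCoord.basis_apply, GaCoord.coord_T_pow k p r i m.2, ← Bialgebra.counitAlgHom_apply,
      map_pow, GaCoord.counitAlgHom_T, hi, zero_pow_eq]
  rw [← pair_univ, h]
  exact (isPoint_restrict (univ k p r H)).counit f

/-- Compatibility of the universal subgroup with comultiplication, contracted with the functionals
dual to `T^i` and `T^j`. -/
theorem choose_smul_univCoeff (i j n : Fin (p ^ r)) (hn : (n : ℕ) = i + j) (f : H) :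
    ((n : ℕ).choose i : k) • univCoeff k p r H n f =
      LinearMap.mul' k _ (TensorProduct.map (univCoeff k p r H i) (univCoeff k p r H j)
        (Coalgebra.comul f)) := by
  rw [univCoeff_eq_comp i, univCoeff_eq_comp j, ← pair_conv,
    ← (isPoint_restrict (univ k p r H)).comul, pair_lTensor,
    GaCoord.tensorFunctional_comul k p r i j n hn, ← pair_univ, restrict_apply]
  generalize univ k p r H (1 ⊗ₜ f) = z
  induction z with
  | zero => simp
  | add x y hx hy => rw [map_add, map_add, smul_add, hx, hy]
  | tmul a v => rw [pair_tmul, pair_tmul, LinearMap.smul_apply, smul_assoc]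

/-- Strong induction on `n`, splitting off the leading power of `p` in `n`. -/
theorem univCoeff_mem_adjoin (n : Fin (p ^ r)) (f : H) : univCoeff k p r H n f ∈
    Algebra.adjoin k {a | ∃ i < r, a ∈ homog k p r H (p ^ i)} := by
  have hp : p.Prime := Fact.out
  obtain ⟨n, hn⟩ := n
  induction n using Nat.strong_induction_on generalizing f with
  | _ n ih =>
    rcases eq_or_ne n 0 with h0 | h0
    · rw [univCoeff_zero _ h0]
      exact Subalgebra.algebraMap_mem _ _
    · have hle : p ^ Nat.log p n ≤ n := Nat.pow_log_le_self p h0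
      have hlog : Nat.log p n < r := (Nat.pow_lt_pow_iff_right hp.one_lt).1 (hle.trans_lt hn)
      have hmem : ∀ g, univCoeff k p r H ⟨p ^ Nat.log p n, hle.trans_lt hn⟩ g ∈
          Algebra.adjoin k {a | ∃ i < r, a ∈ homog k p r H (p ^ i)} := fun g =>
        Algebra.subset_adjoin ⟨_, hlog, univCoeff_mem_homog _ g⟩
      rcases hle.eq_or_lt with h1 | h1
      · have h2 : (⟨n, hn⟩ : Fin (p ^ r)) = ⟨p ^ Nat.log p n, hle.trans_lt hn⟩ := Fin.ext h1.symm
        rw [h2]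
        exact hmem f
      -- In characteristic `p` the binomial coefficient is invertible in `k`, so the convolution
      -- identity can be solved for the coefficient of index `n`.
      · have hc : (n.choose (p ^ Nat.log p n) : k) ≠ 0 := fun h =>
          not_dvd_choose_pow_log p h0 ((CharP.cast_eq_zero_iff k p _).1 h)
        have hpos : 0 < p ^ Nat.log p n := pow_pos hp.pos _
        have key := choose_smul_univCoeff (H := H) (k := k) ⟨p ^ Nat.log p n, hle.trans_lt hn⟩
          ⟨n - p ^ Nat.log p n, (Nat.sub_le _ _).trans_lt hn⟩ ⟨n, hn⟩
          (Nat.add_sub_cancel' hle).symm f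
        rw [← inv_smul_smul₀ hc (univCoeff k p r H ⟨n, hn⟩ f)]
        refine Subalgebra.smul_mem _ ?_ _
        rw [key]
        -- In each product the first factor is a generator of degree a power of `p`; the second has
        -- index `n - p ^ Nat.log p n`, smaller than `n`.
        exact mul'_map_mem _ hmem (fun g => ih _ (Nat.sub_lt h0.bot_lt hpos) g _) _

/-- The symbols `x_i(f)` generate the symmetric algebra of which `k[V_r(G)]` is a quotient. -/
theorem eq_top_of_univCoeff_mem (S : Subalgebra k (Coord k p r H))
    (h : ∀ i f, univCoeff k p r H i f ∈ S) : S = ⊤ := by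
  refine eq_top_iff.2 fun a _ => ?_
  obtain ⟨s, rfl⟩ := Coord.mk_surjective a
  induction s using SymmetricAlgebra.induction with
  | algebraMap c => rw [AlgHom.commutes]; exact S.algebraMap_mem c
  | ι x =>
    have hx : x = ∑ i, Pi.single i (x i) := (Finset.univ_sum_single x).symm
    rw [hx, map_sum, map_sum]
    exact sum_mem fun i _ => h i (x i)
  | mul a b ha hb => rw [map_mul]; exact mul_mem (ha trivial) (hb trivial)
  | add a b ha hb => rw [map_add]; exact add_mem (ha trivial) (hb trivial)

theorem adjoin_homog_prime_pow :
    Algebra.adjoin k {a | ∃ i < r, a ∈ homog k p r H (p ^ i)} = ⊤ :=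
  eq_top_of_univCoeff_mem _ univCoeff_mem_adjoin

/-! ### The grading defined by the coaction -/

instance gradedMonoid_homog : SetLike.GradedMonoid (homog k p r H) where
  one_mem := by
    rw [mem_homog, map_one, Polynomial.monomial_zero_one]
  mul_mem i j a b ha hb := by
    rw [mem_homog] at ha hb ⊢
    rw [map_mul, ha, hb, Polynomial.monomial_mul_monomial]

/-- Components are recovered from the sum by reading off powers of `t`; this gives the independence
of the summands. -/
theorem coeff_coaction_coe (d : DirectSum ℕ fun n => homog k p r H n) (n : ℕ) :
    (coaction k p r H (DirectSum.coeAddMonoidHom (homog k p r H) d)).coeff n = d n := by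
  induction d using DirectSum.induction_on with
  | zero => simp
  | of i x =>
    rw [DirectSum.coeAddMonoidHom_of, (mem_homog k p r H).1 x.2, Polynomial.coeff_monomial,
      DirectSum.coe_of_apply]
    split_ifs <;> rfl
  | add x y hx hy => rw [map_add, map_add, Polynomial.coeff_add, hx, hy]; rfl

theorem isInternal_homog : DirectSum.IsInternal (homog k p r H) := by
  constructor
  · intro d e hde
    refine DFinsupp.ext fun n => Subtype.ext ?_
    exact (coeff_coaction_coe d n).symm.trans
      ((congrArg (fun a => (coaction k p r H a).coeff n) hde).trans (coeff_coaction_coe e n))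
  -- The sum of the summands is a subalgebra, so it is everything once it contains the generators.
  · have h : (DirectSum.coeAlgHom (homog k p r H)).range = ⊤ :=
      eq_top_of_univCoeff_mem _ fun i f =>
        ⟨DirectSum.of (fun n => homog k p r H n) i ⟨_, univCoeff_mem_homog i f⟩,
          DirectSum.coeAlgHom_of _ _ _⟩
    intro a
    obtain ⟨d, hd⟩ := (h ▸ Algebra.mem_top : a ∈ (DirectSum.coeAlgHom (homog k p r H)).range)
    exact ⟨d, hd⟩

/-! ### The operator `Θ` and group algebras -/

theorem theta_apply (hr : 0 < r) (f : H) : theta k p r H hr f =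
    univCoeff k p r H ⟨p ^ (r - 1), Nat.pow_lt_pow_right (Fact.out : p.Prime).one_lt
      (Nat.sub_lt hr one_pos)⟩ f :=
  pair_univ _ f

theorem theta_mem_homog (hr : 0 < r) (f : H) :
    theta k p r H hr f ∈ homog k p r H (p ^ (r - 1)) := by
  rw [theta_apply]
  exact univCoeff_mem_homog _ f

/-- The element of `kG ⊗ R` attached to `u_{r-1} ⊗ 1`, viewed as a linear map `k[G] → R`, is
`Θ_{G,r}`. -/
theorem dualTensorHom_groupAlgebraMap_uTop [Module.Finite k H] (hr : 0 < r) :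
    dualTensorHom k H (Coord k p r H)
      (groupAlgebraMap (univ k p r H) (uTop k p r hr ⊗ₜ[k] 1)) = theta k p r H hr := by
  -- `groupAlgebraMap` ends with the inverse of this identification, which cancels; what is left is
  -- the form attached to `u_{r-1} ⊗ 1`, precomposed with the universal subgroup.
  refine ((dualTensorHomEquiv k H (Coord k p r H)).apply_symm_apply _).trans ?_
  have h : ∀ z : Coord k p r H ⊗[k] GaCoord k p r,
      LinearMap.liftBaseChangeEquiv (Coord k p r H)
        (dualTensorHom k (GaCoord k p r) (Coord k p r H) (uTop k p r hr ⊗ₜ[k] 1)) z =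
      pair (Coord k p r H) (uTop k p r hr) z := by
    intro z
    induction z with
    | zero => simp
    | add x y hx hy => rw [map_add, map_add, hx, hy]
    | tmul a v => simp
  ext f
  exact h (univ k p r H (1 ⊗ₜ f))

end Grading

/-- Under `V* ⊗ R = Hom(V, R)`, the linear maps with values in `W` are the sums of tensors whose
second factors lie in `W`. -/
theorem forall_dualTensorHom_mem_iff {k V R : Type*} [Field k] [AddCommGroup V] [Module k V]
    [Module.Finite k V] [AddCommGroup R] [Module k R] (W : Submodule k R)
    (z : Module.Dual k V ⊗[k] R) :
    (∀ v, dualTensorHom k V R z v ∈ W) ↔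
      ∃ (n : ℕ) (x : Fin n → Module.Dual k V) (a : Fin n → R),
        (∀ i, a i ∈ W) ∧ z = ∑ i, x i ⊗ₜ[k] a i := by
  constructor
  · intro h
    let b := Module.finBasis k V
    -- Expansion in the dual basis: a map `φ` corresponds to the tensor `∑ b_i^* ⊗ φ(b_i)`.
    refine ⟨_, b.coord, fun i => dualTensorHom k V R z (b i), fun i => h _, ?_⟩
    apply (dualTensorHomEquiv k V R).injective
    refine b.ext fun j => ?_
    simp [Finsupp.single_apply]
  · rintro ⟨n, x, a, ha, rfl⟩ v
    rw [map_sum, LinearMap.sum_apply]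
    exact sum_mem fun i _ => W.smul_mem _ (ha i)

end OneParam

/-- `G = Spec H` is an algebraic affine group scheme over a field `k` of characteristic `p`. -/
theorem proposition2p11 {k : Type*} [Field k] (p : ℕ) [Fact p.Prime] [CharP k p]
    (H : Type*) [CommRing H] [HopfAlgebra k H] [Algebra.FiniteType k H] (r : ℕ) (hr : 0 < r) :
    -- the summands `homog n` form a grading of the algebra `k[V_r(G)]`, and this graded algebra
    -- is generated by homogeneous elements of degrees `p^i`, `0 ≤ i < r`
    (SetLike.GradedMonoid (OneParam.homog k p r H) ∧
      DirectSum.IsInternal (OneParam.homog k p r H) ∧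
      Algebra.adjoin k {a | ∃ i < r, a ∈ OneParam.homog k p r H (p ^ i)} = ⊤) ∧
    -- the image of `Θ_{G,r}` lies in the summand of degree `p^{r-1}`
    (∀ f : H, OneParam.theta k p r H hr f ∈ OneParam.homog k p r H (p ^ (r - 1))) ∧
    -- for infinitesimal `G`, this is equivalent to the statement on group algebras
    (∀ [Module.Finite k H] [IsLocalRing H],
      (∃ s : ℕ, ∀ x ∈ IsLocalRing.maximalIdeal H, x ^ p ^ s = 0) →
      ((∀ f : H, OneParam.theta k p r H hr f ∈ OneParam.homog k p r H (p ^ (r - 1))) ↔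
        ∃ (n : ℕ) (x : Fin n → Module.Dual k H) (a : Fin n → OneParam.Coord k p r H),
          (∀ i, a i ∈ OneParam.homog k p r H (p ^ (r - 1))) ∧
          OneParam.groupAlgebraMap (OneParam.univ k p r H)
            (OneParam.uTop k p r hr ⊗ₜ[k] 1) = ∑ i, x i ⊗ₜ[k] a i)) := by
  refine ⟨⟨OneParam.gradedMonoid_homog, OneParam.isInternal_homog,
    OneParam.adjoin_homog_prime_pow⟩, OneParam.theta_mem_homog hr, ?_⟩
  intro _ _ _
  -- Read as a condition on the values of the corresponding linear map, which is `Θ`, the right-hand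
  -- side becomes the left-hand side.
  rw [← OneParam.forall_dualTensorHom_mem_iff, OneParam.dualTensorHom_groupAlgebraMap_uTop]
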